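/- Let $p$ be a prime, $s\ge 1$, and let $m,n,d$ be integers with $n\ge m\ge d\ge 2$. For $A\in\mathbb{Z}_{p^s}^{m\times n}$ let $\rho(A)$ be the inner rank of $A$, i.e. $\rho(0)=0$ and, for $A\ne 0$, $\rho(A)$ is the least positive integer $r$ such that $A=BC$ with $B\in\mathbb{Z}_{p^s}^{m\times r}$ and $C\in\mathbb{Z}_{p^s}^{r\times n}$. Let $\Gamma_d(\mathbb{Z}_{p^s}^{m\times n})$ be the graph with vertex set $\mathbb{Z}_{p^s}^{m\times n}$ in which two distinct matrices $A,B$ are adjacent if and only if $\rho(A-B)<d$. A largest independent set is an independent set of maximum cardinality. (1) Every largest independent set $\mathcal{S}$ of $\Gamma_d(\mathbb{Z}_{p^s}^{m\times n})$ is an $(m\times n,d)$ MRD code over $\mathbb{Z}_{p^s}$, i.e. $\rho(A-B)\ge d$ for all distinct $A,B\in\mathcal{S}$ and $|\mathcal{S}|=p^{sn(m-d+1)}$. Moreover, viewed as a code of length $m$ whose letters are the rows of the matrices, over the alphabet $\mathbb{Z}_{p^s}^{n}$ of size $q=p^{sn}$, $\mathcal{S}$ is an $(m,M,d)$ MDS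 code with $M=p^{sn(m-d+1)}$, i.e. $|\mathcal{S}|=M$, the minimum Hamming distance between distinct codewords is exactly $d$, and $d=m-\log_q M+1$. (2) There is a largest independent set of $\Gamma_d(\mathbb{Z}_{p^s}^{m\times n})$ that is a linear code over $\mathbb{Z}_{p^s}$, i.e. a $\mathbb{Z}_{p^s}$-submodule of $\mathbb{Z}_{p^s}^{m\times n}$. -/

import Mathlib

/-- The inner rank of `A`: the least `r` for which `A = B * C` with `B` of size `m × r` and `C` of
size `r × n`. A factorization through `r = 0` exists exactly when `A = 0`, so the value is `0` at
`A = 0` and is the least positive such `r` at every `A ≠ 0`. The set is never empty (`A = 1 * A`). -/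
noncomputable def innerRank {R : Type*} [CommRing R] {m n : ℕ}
    (A : Matrix (Fin m) (Fin n) R) : ℕ :=
  sInf {r : ℕ | ∃ (B : Matrix (Fin m) (Fin r) R) (C : Matrix (Fin r) (Fin n) R), A = B * C}

theorem innerRank_neg {R : Type*} [CommRing R] {m n : ℕ} (A : Matrix (Fin m) (Fin n) R) :
    innerRank (-A) = innerRank A := by
  unfold innerRank
  congr 1
  ext r
  constructor
  · rintro ⟨B, C, h⟩
    exact ⟨-B, C, by rw [Matrix.neg_mul, ← h, neg_neg]⟩
  · rintro ⟨B, C, h⟩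
    exact ⟨-B, C, by rw [Matrix.neg_mul, ← h]⟩

/-- The rank distance `ρ(A - B)`. -/
noncomputable def rankDist {R : Type*} [CommRing R] {m n : ℕ}
    (A B : Matrix (Fin m) (Fin n) R) : ℕ :=
  innerRank (A - B)

theorem rankDist_comm {R : Type*} [CommRing R] {m n : ℕ} (A B : Matrix (Fin m) (Fin n) R) :
    rankDist A B = rankDist B A := by
  rw [rankDist, rankDist, ← innerRank_neg, neg_sub]

/-- The generalized bilinear forms graph on `R^{m × n}`: distinct matrices `A`, `B` are adjacent
when `ρ(A - B) < d`. -/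
def bilinearFormsGraph (R : Type*) [CommRing R] (m n d : ℕ) :
    SimpleGraph (Matrix (Fin m) (Fin n) R) where
  Adj A B := A ≠ B ∧ rankDist A B < d
  symm := ⟨fun A B h => ⟨h.1.symm, by rw [rankDist_comm]; exact h.2⟩⟩
  loopless := ⟨fun _ h => h.1 rfl⟩

/-- An `(m × n, d)` rank distance code over `R`. -/
def IsRankDistanceCode {R : Type*} [CommRing R] {m n : ℕ} (d : ℕ)
    (C : Finset (Matrix (Fin m) (Fin n) R)) : Prop :=
  ∀ A ∈ C, ∀ B ∈ C, A ≠ B → d ≤ rankDist A B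

/-- An `(m × n, d)` maximum rank distance code over `ℤ / p ^ s` (in the range `d ≤ m ≤ n`): a rank
distance code that attains the Singleton bound `p ^ (s n (m - d + 1))`. -/
def IsMRDCode (p s : ℕ) {m n : ℕ} (d : ℕ)
    (C : Finset (Matrix (Fin m) (Fin n) (ZMod (p ^ s)))) : Prop :=
  IsRankDistanceCode d C ∧ C.card = p ^ (s * n * (m - d + 1))

/-- An `(N, M, d)` code over the finite alphabet `F`: a nonempty set of `M` words of length `N`
whose minimum Hamming distance between distinct codewords is exactly `d`. -/
def IsCode {F : Type*} [DecidableEq F] (N M d : ℕ) (C : Finset (Fin N → F)) : Prop :=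
  C.Nonempty ∧ C.card = M ∧
    IsLeast {k : ℕ | ∃ a ∈ C, ∃ b ∈ C, a ≠ b ∧ hammingDist a b = k} d

/-- An `(N, M, d)` MDS code over the finite alphabet `F`: an `(N, M, d)` code that attains the
Singleton bound `d ≤ N - log_q M + 1`, where `q = |F|`. -/
def IsMDSCode {F : Type*} [Fintype F] [DecidableEq F] (N M d : ℕ)
    (C : Finset (Fin N → F)) : Prop :=
  IsCode N M d C ∧ (d : ℝ) = (N : ℝ) - Real.logb (Fintype.card F : ℝ) (M : ℝ) + 1

/-- A set of `m × n` matrices as a set of words of length `m` whose letters are rows. -/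
def rowCode {R : Type*} {m n : ℕ} (C : Finset (Matrix (Fin m) (Fin n) R)) :
    Finset (Fin m → (Fin n → R)) :=
  C.map Matrix.of.symm.toEmbedding

/-- A linear code of matrices over `R`: the underlying set is an `R`-submodule. -/
def IsLinearCode {R : Type*} [CommRing R] {m n : ℕ}
    (C : Finset (Matrix (Fin m) (Fin n) R)) : Prop :=
  ∃ L : Submodule R (Matrix (Fin m) (Fin n) R), (L : Set (Matrix (Fin m) (Fin n) R)) = ↑C

/-!
For a matrix `A`, the inner rank is at most the number of nonzero rows, so the rank distance is
bounded by the Hamming distance of the row words. Deleting `d - 1` rows is therefore injective on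
an independent set, which gives the Singleton bound `p ^ (s n (m - d + 1))`
(`IsRankDistanceCode.card_le`).

The bound is attained by a linear code (`exists_linear_isRankDistanceCode`), the lift of a Gabidulin
code. Over `𝔽_p`, one evaluates the additive polynomials `∑ j ≤ m - d, c j * x ^ p ^ j` over
`𝔽_{p ^ n}` at `m` linearly independent points; a nonzero one has at most `p ^ (m - d)` roots,
so its evaluation matrix has rank at least `d` (`exists_gabidulin`). A basis of this code is
lifted to integer matrices and reduced modulo `p ^ s`. A nonzero element of the lifted code is
`p ^ k * M` with `k < s` and `M` of rank at least `d` modulo `p`. A factorization of it through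
`r < d` dimensions lifts to `p ^ k * M' = B * C` over `ℤ` with `M' ≡ M` modulo `p`. Some `d × d`
product `P * M' * Q` then has determinant `1` modulo `p`, whereas `p ^ k * (P * M' * Q)` has
determinant `0`, a contradiction (`le_innerRank_pow_smul`).

Hence every largest independent set has exactly `p ^ (s n (m - d + 1))` elements. As a row code it
attains the classical Singleton bound for distance `d`; it violates that bound for distance
`d + 1`, so its minimum Hamming distance is exactly `d` (`isMDSCode_of_card_eq`).
-/

/-! ### The Singleton bound -/

theorem innerRank_le_of_mul {R : Type*} [CommRing R] {m n r : ℕ} {A : Matrix (Fin m) (Fin n) R}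
    (B : Matrix (Fin m) (Fin r) R) (C : Matrix (Fin r) (Fin n) R) (h : A = B * C) :
    innerRank A ≤ r :=
  Nat.sInf_le ⟨B, C, h⟩

theorem exists_eq_mul_innerRank {R : Type*} [CommRing R] {m n : ℕ}
    (A : Matrix (Fin m) (Fin n) R) :
    ∃ (B : Matrix (Fin m) (Fin (innerRank A)) R) (C : Matrix (Fin (innerRank A)) (Fin n) R),
      A = B * C :=
  Nat.sInf_mem (s := {r : ℕ | ∃ (B : Matrix (Fin m) (Fin r) R) (C : Matrix (Fin r) (Fin n) R),
    A = B * C}) ⟨m, 1, A, by simp⟩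

/-- Selecting the rows outside of which `A` vanishes factors `A` through `R ^ t.card`. -/
theorem innerRank_le_card {R : Type*} [CommRing R] {m n : ℕ} (A : Matrix (Fin m) (Fin n) R)
    (t : Finset (Fin m)) (h : ∀ i ∉ t, A i = 0) : innerRank A ≤ t.card := by
  let e : Fin t.card ≃ t := t.equivFin.symm
  refine innerRank_le_of_mul (Matrix.of fun i k => if i = (e k : Fin m) then 1 else 0)
    (Matrix.of fun k => A (e k)) ?_
  ext i j
  simp only [Matrix.mul_apply, Matrix.of_apply, ite_mul, one_mul, zero_mul]
  rw [e.sum_comp (fun x : t => if i = (x : Fin m) then A x j else 0),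
    Finset.sum_coe_sort t (fun x => if i = x then A x j else 0), Finset.sum_ite_eq]
  split_ifs with hi
  · rfl
  · rw [h i hi]; rfl

theorem rankDist_le_hammingDist {R : Type*} [CommRing R] [DecidableEq R] {m n : ℕ}
    (A B : Matrix (Fin m) (Fin n) R) :
    rankDist A B ≤ hammingDist (Matrix.of.symm A) (Matrix.of.symm B) := by
  refine innerRank_le_card _ _ fun i hi => ?_
  simp only [Finset.mem_filter, Finset.mem_univ, true_and, not_not] at hi
  exact sub_eq_zero.mpr hi

/-- The Singleton bound for words over an arbitrary alphabet: deleting the last `d - 1` letters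
is injective on a code of minimum distance at least `d`. -/
theorem card_le_pow_of_le_hammingDist {F : Type*} [Fintype F] [DecidableEq F] {N d : ℕ}
    (hd : 1 ≤ d) (hdN : d ≤ N + 1) (C : Finset (Fin N → F))
    (h : ∀ a ∈ C, ∀ b ∈ C, a ≠ b → d ≤ hammingDist a b) :
    C.card ≤ Fintype.card F ^ (N + 1 - d) := by
  have hk : N + 1 - d ≤ N := by omega
  let π : (Fin N → F) → (Fin (N + 1 - d) → F) := fun a i => a (Fin.castLE hk i)
  have hinj : Set.InjOn π C := by
    intro a ha b hb hab
    by_contra hne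
    have h1 := h a ha b hb hne
    have h2 : hammingDist a b ≤
        (Finset.univ.filter fun i : Fin N => N + 1 - d ≤ (i : ℕ)).card := by
      refine Finset.card_le_card fun i hi => ?_
      simp only [Finset.mem_filter, Finset.mem_univ, true_and] at hi ⊢
      by_contra hlt
      exact hi (congrFun hab ⟨i, by omega⟩)
    have h3 : (Finset.univ.filter fun i : Fin N => N + 1 - d ≤ (i : ℕ)).card ≤ d - 1 := by
      have : ((Finset.univ.filter fun i : Fin N => N + 1 - d ≤ (i : ℕ)).map
          Fin.valEmbedding) ⊆ Finset.Ico (N + 1 - d) N := by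
        intro x hx
        simp only [Finset.mem_map, Finset.mem_filter, Finset.mem_univ, true_and,
          Fin.valEmbedding_apply, Finset.mem_Ico] at hx ⊢
        obtain ⟨i, hi, rfl⟩ := hx
        exact ⟨hi, i.2⟩
      have := Finset.card_le_card this
      rw [Finset.card_map, Nat.card_Ico] at this
      omega
    omega
  calc C.card = (C.image π).card := (Finset.card_image_of_injOn hinj).symm
    _ ≤ Fintype.card (Fin (N + 1 - d) → F) := Finset.card_le_univ _
    _ = Fintype.card F ^ (N + 1 - d) := by simp

theorem le_hammingDist_rowCode {R : Type*} [CommRing R] [DecidableEq R] {m n d : ℕ}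
    {C : Finset (Matrix (Fin m) (Fin n) R)} (h : IsRankDistanceCode d C) :
    ∀ a ∈ rowCode C, ∀ b ∈ rowCode C, a ≠ b → d ≤ hammingDist a b := by
  intro a ha b hb hab
  simp only [rowCode, Finset.mem_map] at ha hb
  obtain ⟨A, hA, rfl⟩ := ha
  obtain ⟨B, hB, rfl⟩ := hb
  exact (h A hA B hB fun e => hab (by rw [e])).trans (rankDist_le_hammingDist A B)

theorem IsRankDistanceCode.card_le {R : Type*} [CommRing R] [Fintype R] [DecidableEq R]
    {m n d : ℕ} (hd : 1 ≤ d) (hdm : d ≤ m) {C : Finset (Matrix (Fin m) (Fin n) R)}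
    (h : IsRankDistanceCode d C) : C.card ≤ Fintype.card R ^ (n * (m - d + 1)) := by
  have := card_le_pow_of_le_hammingDist hd (by omega) (rowCode C) (le_hammingDist_rowCode h)
  rwa [rowCode, Finset.card_map, Fintype.card_fun, Fintype.card_fin, ← pow_mul,
    show m + 1 - d = m - d + 1 by omega] at this

/-! ### Maximum rank distance codes are MDS -/

theorem isMDSCode_of_card_eq {F : Type*} [Fintype F] [DecidableEq F] {N d : ℕ}
    (hF : 1 < Fintype.card F) (hd : 1 ≤ d) (hdN : d ≤ N) (C : Finset (Fin N → F))
    (h : ∀ a ∈ C, ∀ b ∈ C, a ≠ b → d ≤ hammingDist a b)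
    (hC : C.card = Fintype.card F ^ (N - d + 1)) :
    IsMDSCode N (Fintype.card F ^ (N - d + 1)) d C := by
  refine ⟨⟨?_, hC, ?_, ?_⟩, ?_⟩
  · rw [← Finset.card_pos, hC]
    exact pow_pos (by omega) _
  · -- If all distances were at least `d + 1`, the Singleton bound would be violated.
    by_contra hno
    have h' : ∀ a ∈ C, ∀ b ∈ C, a ≠ b → d + 1 ≤ hammingDist a b := fun a ha b hb hab =>
      lt_of_le_of_ne (h a ha b hb hab) fun e => hno ⟨a, ha, b, hb, hab, e.symm⟩
    have hle := card_le_pow_of_le_hammingDist (by omega) (by omega) C h'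
    rw [hC] at hle
    have := (Nat.pow_le_pow_iff_right hF).mp hle
    omega
  · rintro k ⟨a, ha, b, hb, hab, rfl⟩
    exact h a ha b hb hab
  · have hF' : (1 : ℝ) < Fintype.card F := by exact_mod_cast hF
    rw [Nat.cast_pow, Real.logb_pow, Real.logb_self_eq_one hF']
    push_cast [Nat.cast_sub hdN]
    ring

/-! ### Gabidulin codes over a prime field -/

/-- The additive polynomial map `x ↦ ∑ j, c j * x ^ p ^ j` of a field of characteristic `p`, as a
linear map over the prime field. -/
noncomputable def additivePolyMap (p : ℕ) [Fact p.Prime] (K : Type*) [Field K] [Algebra (ZMod p) K]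
    [CharP K p] {k : ℕ} (c : Fin k → K) : K →ₗ[ZMod p] K :=
  AddMonoidHom.toZModLinearMap p
    { toFun := fun x => ∑ j, c j * x ^ p ^ (j : ℕ)
      map_zero' := by simp [(Fact.out : p.Prime).ne_zero]
      map_add' := fun x y => by
        simp_rw [add_pow_char_pow, mul_add, Finset.sum_add_distrib] }

theorem additivePolyMap_apply {p : ℕ} [Fact p.Prime] {K : Type*} [Field K] [Algebra (ZMod p) K]
    [CharP K p] {k : ℕ} (c : Fin k → K) (x : K) :
    additivePolyMap p K c x = ∑ j, c j * x ^ p ^ (j : ℕ) := rfl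

/-- The kernel consists of the roots of a nonzero polynomial of degree at most `p ^ (k - 1)`. -/
theorem finrank_ker_additivePolyMap_lt {p : ℕ} [Fact p.Prime] {K : Type*} [Field K]
    [Algebra (ZMod p) K] [CharP K p] [Finite K] {k : ℕ} {c : Fin k → K} (hc : c ≠ 0) :
    Module.finrank (ZMod p) (LinearMap.ker (additivePolyMap p K c)) < k := by
  have hp : p.Prime := Fact.out
  obtain ⟨j₀, hj₀⟩ := Function.ne_iff.mp hc
  have hk : 1 ≤ k := by have := j₀.2; omega
  let f : Polynomial K := ∑ j, Polynomial.C (c j) * Polynomial.X ^ p ^ (j : ℕ)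
  have hf0 : f ≠ 0 := by
    intro h
    apply hj₀
    have : f.coeff (p ^ (j₀ : ℕ)) = c j₀ := by
      simp only [f, Polynomial.finsetSum_coeff, Polynomial.coeff_C_mul_X_pow]
      rw [Finset.sum_eq_single j₀]
      · simp
      · intro j _ hj
        rw [if_neg]
        intro e
        exact hj (Fin.ext (Nat.pow_right_injective hp.two_le e).symm)
      · simp
    rw [← this, h]; simp
  have hdeg : f.natDegree ≤ p ^ (k - 1) := by
    refine Polynomial.natDegree_sum_le_of_forall_le _ _ fun j _ => ?_
    refine (Polynomial.natDegree_C_mul_X_pow_le _ _).trans ?_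
    exact Nat.pow_le_pow_right hp.pos (by have := j.2; omega)
  have hsub : (LinearMap.ker (additivePolyMap p K c) : Set K) ⊆ f.rootSet K := by
    intro x hx
    rw [SetLike.mem_coe, LinearMap.mem_ker, additivePolyMap_apply] at hx
    rw [Polynomial.mem_rootSet]
    exact ⟨hf0, by simpa [f] using hx⟩
  have hcard : Nat.card (LinearMap.ker (additivePolyMap p K c)) ≤ p ^ (k - 1) :=
    calc Nat.card (LinearMap.ker (additivePolyMap p K c))
        ≤ (f.rootSet K).ncard := Set.ncard_le_ncard hsub (Set.toFinite _)
      _ ≤ f.natDegree := Polynomial.ncard_rootSet_le f K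
      _ ≤ _ := hdeg
  rw [Module.natCard_eq_pow_finrank (K := ZMod p), Nat.card_zmod] at hcard
  have := (Nat.pow_le_pow_iff_right hp.one_lt).mp hcard
  omega

/-- A linear map whose range has dimension at least `d` restricts and corestricts to the identity
of `F ^ d`. -/
theorem exists_comp_comp_eq_id {F V W : Type*} [Field F] [AddCommGroup V] [Module F V]
    [AddCommGroup W] [Module F W] [FiniteDimensional F W] (T : V →ₗ[F] W) {d : ℕ}
    (h : d ≤ Module.finrank F (LinearMap.range T)) :
    ∃ (P : W →ₗ[F] (Fin d → F)) (Q : (Fin d → F) →ₗ[F] V), P ∘ₗ T ∘ₗ Q = LinearMap.id := by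
  obtain ⟨v, hv⟩ := exists_linearIndependent_of_le_finrank h
  choose u hu using fun i => (v i).2
  let Q : (Fin d → F) →ₗ[F] V := Fintype.linearCombination F u
  have hinj : LinearMap.ker (T ∘ₗ Q) = ⊥ := by
    have hv' : LinearIndependent F fun i => (v i : W) :=
      hv.map' (LinearMap.range T).subtype (Submodule.ker_subtype _)
    have hTQ : T ∘ₗ Q = Fintype.linearCombination F fun i => (v i : W) := by
      refine LinearMap.ext fun x => ?_
      simp [Q, Fintype.linearCombination_apply, hu]
    rw [hTQ, LinearMap.ker_eq_bot]
    exact linearIndependent_iff_injective_fintypeLinearCombination.mp hv'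
  obtain ⟨P, hP⟩ := LinearMap.exists_leftInverse_of_injective _ hinj
  exact ⟨P, Q, hP⟩

/-- The Gabidulin code. The additive polynomials with coefficients `c : Fin k → 𝔽_{p ^ n}` are
evaluated at `m` linearly independent elements of `𝔽_{p ^ n}`, so the dimension of the resulting
matrix is `m` minus that of the kernel. That the rank is at least `d` is expressed by a factor
`P * A * Q = 1`, which survives lifting to characteristic zero. -/
theorem exists_gabidulin (p : ℕ) [Fact p.Prime] {m n d : ℕ} (hd : 1 ≤ d) (hdm : d ≤ m)
    (hmn : m ≤ n) :
    ∃ Φ : (Fin (m - d + 1) × Fin n → ZMod p) →ₗ[ZMod p] Matrix (Fin m) (Fin n) (ZMod p),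
      ∀ v ≠ 0, ∃ (P : Matrix (Fin d) (Fin m) (ZMod p)) (Q : Matrix (Fin n) (Fin d) (ZMod p)),
        P * Φ v * Q = 1 := by
  have hn : n ≠ 0 := by omega
  let K := GaloisField p n
  let b : Module.Basis (Fin n) (ZMod p) K :=
    Module.finBasisOfFinrankEq (ZMod p) K (GaloisField.finrank p hn)
  let c (v : Fin (m - d + 1) × Fin n → ZMod p) (j : Fin (m - d + 1)) : K :=
    b.equivFun.symm fun i => v (j, i)
  have hc (v) (hv : v ≠ 0) : c v ≠ 0 := by
    intro h
    apply hv
    ext ⟨j, i⟩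
    have := (LinearEquiv.map_eq_zero_iff _).mp (congrFun h j)
    exact congrFun this i
  let g : (Fin m → ZMod p) →ₗ[ZMod p] K :=
    Fintype.linearCombination (ZMod p) fun i => b (Fin.castLE hmn i)
  have hg : LinearMap.ker g = ⊥ :=
    LinearMap.ker_eq_bot.mpr <| linearIndependent_iff_injective_fintypeLinearCombination.mp
      (b.linearIndependent.comp _ (Fin.castLE_injective hmn))
  let T (v) : (Fin m → ZMod p) →ₗ[ZMod p] (Fin n → ZMod p) :=
    b.equivFun.toLinearMap ∘ₗ additivePolyMap p K (c v) ∘ₗ g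
  have hrank (v) (hv : v ≠ 0) : d ≤ Module.finrank (ZMod p) (LinearMap.range (T v)) := by
    have h1 := LinearMap.finrank_range_add_finrank_ker (T v)
    have h2 : Module.finrank (ZMod p) (LinearMap.ker (T v)) ≤
        Module.finrank (ZMod p) (LinearMap.ker (additivePolyMap p K (c v))) := by
      let g' : LinearMap.ker (T v) →ₗ[ZMod p] LinearMap.ker (additivePolyMap p K (c v)) :=
        g.restrict fun x hx => by
          rw [LinearMap.mem_ker] at hx ⊢
          exact (LinearEquiv.map_eq_zero_iff b.equivFun).mp hx
      refine LinearMap.finrank_le_finrank_of_injective (f := g') fun x y hxy => ?_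
      exact Subtype.ext (LinearMap.ker_eq_bot.mp hg (congrArg Subtype.val hxy))
    have h3 := finrank_ker_additivePolyMap_lt (hc v hv)
    rw [Module.finrank_fin_fun] at h1
    omega
  have hadd (v w) : T (v + w) = T v + T w := by
    refine LinearMap.ext fun x => ?_
    have : c (v + w) = c v + c w := by
      ext j
      exact map_add b.equivFun.symm (fun i => v (j, i)) (fun i => w (j, i))
    simp only [T, LinearMap.comp_apply, LinearMap.add_apply, ← map_add]
    congr 1
    simp [additivePolyMap_apply, this, add_mul, Finset.sum_add_distrib]
  have hsmul (a : ZMod p) (v) : T (a • v) = a • T v := by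
    refine LinearMap.ext fun x => ?_
    have : c (a • v) = a • c v := by
      ext j
      exact map_smul b.equivFun.symm a (fun i => v (j, i))
    simp only [T, LinearMap.comp_apply, LinearMap.smul_apply, ← map_smul]
    congr 1
    simp [additivePolyMap_apply, this, Finset.smul_sum]
  refine ⟨{ toFun := fun v => (LinearMap.toMatrix' (T v)).transpose
            map_add' := fun v w => by rw [hadd, map_add, Matrix.transpose_add]
            map_smul' := fun a v => by
              rw [hsmul, map_smul, Matrix.transpose_smul, RingHom.id_apply] }, fun v hv => ?_⟩
  obtain ⟨P, Q, h⟩ := exists_comp_comp_eq_id (T v) (hrank v hv)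
  refine ⟨(LinearMap.toMatrix' Q).transpose, (LinearMap.toMatrix' P).transpose, ?_⟩
  change (LinearMap.toMatrix' Q).transpose * (LinearMap.toMatrix' (T v)).transpose *
    (LinearMap.toMatrix' P).transpose = 1
  rw [← Matrix.transpose_mul, ← Matrix.transpose_mul, ← LinearMap.toMatrix'_comp,
    ← LinearMap.toMatrix'_comp, h, LinearMap.toMatrix'_id, Matrix.transpose_one]

/-! ### Lifting to `ℤ / p ^ s` -/

theorem det_mul_eq_zero_of_lt {R : Type*} [CommRing R] [IsDomain R] {d r : ℕ} (h : r < d)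
    (B : Matrix (Fin d) (Fin r) R) (C : Matrix (Fin r) (Fin d) R) : (B * C).det = 0 := by
  by_contra hne
  have h1 := Matrix.rank_of_isUnit ((B * C).map (algebraMap R (FractionRing R))) (by
    rw [Matrix.isUnit_iff_isUnit_det, isUnit_iff_ne_zero]
    rw [← RingHom.mapMatrix_apply, ← RingHom.map_det]
    exact (map_ne_zero_iff _ (IsFractionRing.injective R (FractionRing R))).mpr hne)
  rw [Matrix.map_mul] at h1
  have h2 := Matrix.rank_mul_le_left (B.map (algebraMap R (FractionRing R)))
    (C.map (algebraMap R (FractionRing R)))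
  have h3 := Matrix.rank_le_width (B.map (algebraMap R (FractionRing R)))
  rw [Fintype.card_fin] at h1
  omega

theorem exists_map_intCast_eq {N : ℕ} {α β : Type*} (A : Matrix α β (ZMod N)) :
    ∃ A' : Matrix α β ℤ, A'.map (Int.castRingHom (ZMod N)) = A := by
  choose f hf using ZMod.intCast_surjective (n := N)
  exact ⟨A.map f, by ext; simp [hf]⟩

/-- If `M` has rank at least `d` modulo `p`, then no nonzero multiple `p ^ k * M` modulo `p ^ s`
factors through fewer than `d` dimensions: a factorization lifts to
`p ^ k * (M - p ^ (s - k) * E) = B * C` over `ℤ`, and `M - p ^ (s - k) * E` agrees with `M`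
modulo `p`. -/
theorem le_innerRank_pow_smul {p s k m n d : ℕ} [Fact p.Prime] (hk : k < s)
    (M : Matrix (Fin m) (Fin n) ℤ) (P : Matrix (Fin d) (Fin m) (ZMod p))
    (Q : Matrix (Fin n) (Fin d) (ZMod p))
    (h : P * M.map (Int.castRingHom (ZMod p)) * Q = 1) :
    d ≤ innerRank (((p : ℤ) ^ k • M).map (Int.castRingHom (ZMod (p ^ s)))) := by
  have hp : p.Prime := Fact.out
  obtain ⟨B, C, hBC⟩ :=
    exists_eq_mul_innerRank (((p : ℤ) ^ k • M).map (Int.castRingHom (ZMod (p ^ s))))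
  by_contra! hlt
  generalize innerRank (((p : ℤ) ^ k • M).map (Int.castRingHom (ZMod (p ^ s)))) = r at *
  obtain ⟨B, rfl⟩ := exists_map_intCast_eq B
  obtain ⟨C, rfl⟩ := exists_map_intCast_eq C
  obtain ⟨P, rfl⟩ := exists_map_intCast_eq P
  obtain ⟨Q, rfl⟩ := exists_map_intCast_eq Q
  rw [← Matrix.map_mul] at hBC
  have hdvd (i j) : ((p : ℤ) ^ s) ∣ ((p : ℤ) ^ k • M - B * C) i j := by
    have := congrFun (congrFun hBC i) j
    simp only [Matrix.map_apply, eq_intCast] at this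
    have h' := (ZMod.intCast_eq_intCast_iff_dvd_sub _ _ (p ^ s)).mp this.symm
    push_cast at h'
    exact h'
  choose E hE using hdvd
  let M' : Matrix (Fin m) (Fin n) ℤ := M - (p : ℤ) ^ (s - k) • Matrix.of E
  have hM' : (p : ℤ) ^ k • M' = B * C := by
    ext i j
    have := hE i j
    simp only [Matrix.sub_apply, Matrix.smul_apply, smul_eq_mul] at this
    simp only [M', Matrix.sub_apply, Matrix.smul_apply, smul_eq_mul, Matrix.of_apply, mul_sub,
      ← mul_assoc, ← pow_add, show k + (s - k) = s by omega]
    linarith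
  have hmod : M'.map (Int.castRingHom (ZMod p)) = M.map (Int.castRingHom (ZMod p)) := by
    ext i j
    simp [M', show s - k ≠ 0 by omega]
  have hdet : (P * M' * Q).det ≠ 0 := by
    intro h0
    rw [← hmod, ← Matrix.map_mul, ← Matrix.map_mul] at h
    have h1 := congrArg Matrix.det h
    rw [← RingHom.mapMatrix_apply, ← RingHom.map_det, h0, map_zero, Matrix.det_one] at h1
    exact zero_ne_one h1
  have hzero : ((p : ℤ) ^ k • (P * M' * Q)).det = 0 := by
    rw [← Matrix.smul_mul, ← Matrix.mul_smul, hM', ← Matrix.mul_assoc, Matrix.mul_assoc]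
    exact det_mul_eq_zero_of_lt hlt _ _
  rw [Matrix.det_smul] at hzero
  rcases mul_eq_zero.mp hzero with h0 | h0
  · exact pow_ne_zero _ (pow_ne_zero _ (by exact_mod_cast hp.ne_zero)) h0
  · exact hdet h0

/-- A nonzero vector over `ℤ / p ^ s` is `p ^ k` times a vector that is nonzero modulo `p`. -/
theorem exists_eq_pow_smul {p s : ℕ} [Fact p.Prime] {ι : Type*}
    {v : ι → ZMod (p ^ s)} (hv : v ≠ 0) :
    ∃ k < s, ∃ w : ι → ℤ, (∀ i, v i = (((p : ℤ) ^ k * w i : ℤ) : ZMod (p ^ s))) ∧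
      (fun i => (w i : ZMod p)) ≠ 0 := by
  choose u hu using fun i => ZMod.intCast_surjective (v i)
  have hex : ∃ j, ¬ ∀ i, (p : ℤ) ^ j ∣ u i := by
    refine ⟨s, fun h => hv (funext fun i => ?_)⟩
    rw [← hu, Pi.zero_apply, ZMod.intCast_zmod_eq_zero_iff_dvd]
    exact_mod_cast h i
  classical
  -- `j` is the least exponent such that `p ^ j` fails to divide `v`, hence `k = j - 1`.
  have hj := Nat.find_spec hex
  have hmin : ∀ l < Nat.find hex, ∀ i, (p : ℤ) ^ l ∣ u i := fun l hl =>
    not_not.mp (Nat.find_min hex hl)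
  have hjs : Nat.find hex ≤ s := by
    refine Nat.find_min' hex fun h => hv (funext fun i => ?_)
    rw [← hu, Pi.zero_apply, ZMod.intCast_zmod_eq_zero_iff_dvd]
    exact_mod_cast h i
  generalize Nat.find hex = j at *
  cases j with
  | zero => simp at hj
  | succ k =>
    choose w hw using hmin k (Nat.lt_succ_self k)
    refine ⟨k, hjs, w, fun i => by rw [← hw, hu], fun h0 => hj fun i => ?_⟩
    have : (p : ℤ) ∣ w i := (ZMod.intCast_zmod_eq_zero_iff_dvd _ _).mp (congrFun h0 i)
    rw [hw, pow_succ]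
    exact mul_dvd_mul_left _ this

/-- The lift of a Gabidulin code to `ℤ / p ^ s`, as an injective parametrization. -/
theorem exists_linear_rankDistance_code (p s : ℕ) [Fact p.Prime] {m n d : ℕ} (hd : 1 ≤ d)
    (hdm : d ≤ m) (hmn : m ≤ n) :
    ∃ Ψ : (Fin (m - d + 1) × Fin n → ZMod (p ^ s)) →ₗ[ZMod (p ^ s)]
        Matrix (Fin m) (Fin n) (ZMod (p ^ s)),
      ∀ v ≠ 0, d ≤ innerRank (Ψ v) := by
  obtain ⟨Φ, hΦ⟩ := exists_gabidulin p hd hdm hmn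
  choose G hG using fun i => exists_map_intCast_eq (Φ (Pi.single i 1))
  refine ⟨Fintype.linearCombination _ fun i => (G i).map (Int.castRingHom (ZMod (p ^ s))),
    fun v hv => ?_⟩
  obtain ⟨k, hk, w, hvw, hw⟩ := exists_eq_pow_smul hv
  obtain ⟨P, Q, hPQ⟩ := hΦ _ hw
  have hM : (∑ i, w i • G i).map (Int.castRingHom (ZMod p)) = Φ fun i => (w i : ZMod p) := by
    rw [LinearMap.pi_apply_eq_sum_univ Φ]
    ext a b
    simp only [Matrix.map_apply, Matrix.sum_apply, Matrix.smul_apply, smul_eq_mul, map_sum,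
      map_mul]
    refine Finset.sum_congr rfl fun i _ => ?_
    have : Φ (fun j => if i = j then 1 else 0) = Φ (Pi.single i 1) := by
      congr 1
      ext j
      simp [Pi.single_apply, eq_comm]
    rw [this, ← hG]
    rfl
  convert le_innerRank_pow_smul hk (∑ i, w i • G i) P Q (by rw [hM, hPQ])
  ext a b
  simp [Fintype.linearCombination_apply, Matrix.sum_apply, hvw, Finset.mul_sum, mul_assoc]

/-! ### Largest independent sets -/

theorem isIndepSet_bilinearFormsGraph_iff {R : Type*} [CommRing R] {m n d : ℕ}
    {C : Finset (Matrix (Fin m) (Fin n) R)} :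
    (bilinearFormsGraph R m n d).IsIndepSet C ↔ IsRankDistanceCode d C := by
  constructor
  · intro h A hA B hB hAB
    by_contra! hlt
    exact h hA hB hAB ⟨hAB, hlt⟩
  · intro h A hA B hB hAB hadj
    exact absurd hadj.2 (not_lt.mpr (h A hA B hB hAB))

theorem exists_linear_isRankDistanceCode (p s : ℕ) [Fact p.Prime] {m n d : ℕ} (hd : 1 ≤ d)
    (hdm : d ≤ m) (hmn : m ≤ n) :
    ∃ C : Finset (Matrix (Fin m) (Fin n) (ZMod (p ^ s))),
      IsRankDistanceCode d C ∧ C.card = p ^ (s * n * (m - d + 1)) ∧ IsLinearCode C := by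
  classical
  obtain ⟨Ψ, hΨ⟩ := exists_linear_rankDistance_code p s hd hdm hmn
  have hinj : Function.Injective Ψ := by
    rw [injective_iff_map_eq_zero]
    intro v hv
    by_contra hne
    have h1 := hΨ v hne
    have h2 := innerRank_le_card (Ψ v) ∅ fun i _ => by rw [hv]; rfl
    rw [Finset.card_empty] at h2
    omega
  refine ⟨Finset.univ.image Ψ, ?_, ?_, LinearMap.range Ψ, by ext; simp⟩
  · intro A hA B hB hAB
    simp only [Finset.mem_image, Finset.mem_univ, true_and] at hA hB
    obtain ⟨v, rfl⟩ := hA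
    obtain ⟨w, rfl⟩ := hB
    rw [rankDist, ← map_sub]
    exact hΨ _ (sub_ne_zero.mpr fun e => hAB (by rw [e]))
  · rw [Finset.card_image_of_injective _ hinj, Finset.card_univ, Fintype.card_fun, ZMod.card,
      Fintype.card_prod, Fintype.card_fin, Fintype.card_fin, ← pow_mul]
    congr 1
    ring

theorem theorem3p5 (p s m n d : ℕ) [Fact p.Prime] (hs : 1 ≤ s)
    (hd : 2 ≤ d) (hdm : d ≤ m) (hmn : m ≤ n) :
    (∀ S : Finset (Matrix (Fin m) (Fin n) (ZMod (p ^ s))),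
      (bilinearFormsGraph (ZMod (p ^ s)) m n d).IsMaximumIndepSet S →
        IsMRDCode p s d S ∧
        Fintype.card (Fin n → ZMod (p ^ s)) = p ^ (s * n) ∧
        IsMDSCode m (p ^ (s * n * (m - d + 1))) d (rowCode S)) ∧
    ∃ C : Finset (Matrix (Fin m) (Fin n) (ZMod (p ^ s))),
      (bilinearFormsGraph (ZMod (p ^ s)) m n d).IsMaximumIndepSet C ∧ IsLinearCode C := by
  have hp : p.Prime := Fact.out
  have hbound {T : Finset (Matrix (Fin m) (Fin n) (ZMod (p ^ s)))}
      (hT : IsRankDistanceCode d T) : T.card ≤ p ^ (s * n * (m - d + 1)) := by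
    have := hT.card_le (by omega) hdm
    rwa [ZMod.card, ← pow_mul, ← mul_assoc] at this
  have hcard : Fintype.card (Fin n → ZMod (p ^ s)) = p ^ (s * n) := by
    rw [Fintype.card_fun, ZMod.card, Fintype.card_fin, ← pow_mul]
  obtain ⟨C, hC, hCcard, hlin⟩ :=
    exists_linear_isRankDistanceCode p s (by omega : 1 ≤ d) hdm hmn
  refine ⟨fun S hS => ?_, C, ⟨isIndepSet_bilinearFormsGraph_iff.mpr hC, fun T hT => ?_⟩, hlin⟩
  · have hS' := isIndepSet_bilinearFormsGraph_iff.mp hS.isIndepSet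
    have hScard : S.card = p ^ (s * n * (m - d + 1)) :=
      le_antisymm (hbound hS')
        (hCcard ▸ hS.maximum C (isIndepSet_bilinearFormsGraph_iff.mpr hC))
    refine ⟨⟨hS', hScard⟩, hcard, ?_⟩
    rw [pow_mul, ← hcard]
    refine isMDSCode_of_card_eq ?_ (by omega) hdm _ (le_hammingDist_rowCode hS') ?_
    · rw [hcard]
      exact Nat.one_lt_pow (Nat.mul_ne_zero (by omega) (by omega)) hp.one_lt
    · rw [rowCode, Finset.card_map, hScard, hcard, pow_mul]
  · rw [hCcard]
    exact hbound (isIndepSet_bilinearFormsGraph_iff.mp hT)
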